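/- Let $\mathbb R^5_1$ be $\mathbb R^5$ with the Lorentzian scalar product $\langle x,y\rangle_L=x_1y_1+x_2y_2+x_3y_3+x_4y_4-x_5y_5$, and let $H^4=\{x\in\mathbb R^5_1 : \langle x,x\rangle_L=-1,\ x_5>0\}$ be the hyperbolic space with the induced Riemannian metric. Let $a_1,a_2,b_1,b_2,b_3\in\mathbb C$ satisfy $$a_1^2+b_1^2+b_2^2=0,\qquad a_1a_2=-b_2^2,\qquad a_1b_3=b_1b_2,\qquad a_1b_1b_2\neq 0,$$ and put $$P(x)=a_1(x_1^2-x_2^2)+a_2(x_2^2-x_3^2)+2b_1x_1x_2+2b_2x_1x_3+2b_3x_2x_3,\qquad Q(x)=(x_4-x_5)^2 .$$ Then $Q$ has no zero on $H^4$, and the globally defined function $\Phi^*=P/Q:H^4\to\mathbb C$ is a harmonic morphism: it is smooth, and for every open $U\subseteq\mathbb C$ and every harmonic $f:U\to\mathbb R$ the composition $f\circ\Phi^*$ is harmonic (with respect to the Laplace–Beltrami operator of $H^4$) on $(\Phi^*)^{-1}(U)$. Moreover, for every non-zero $\alpha$ in the image of $\Phi^*$ the fibre $$(\Phi^*)^{-1}(\{\alpha\})=\{x\in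 H^4 : P(x)=\alpha\,Q(x)\}$$ is a complete minimal surface in $H^4$, that is, a smooth embedded (not necessarily connected) two-dimensional submanifold of $H^4$ with vanishing mean curvature vector that is geodesically complete in the induced metric. -/

import Mathlib

open scoped ContDiff

noncomputable section

/-- The vector space underlying the Minkowski space `ℝ⁵₁`; the coordinates `x₁, …, x₅` are
`x 0, …, x 4`. -/
abbrev R51 : Type := Fin 5 → ℝ

/-- The Lorentzian scalar product of `ℝ⁵₁`; the last coordinate is the timelike one. -/
def lor (x y : R51) : ℝ :=
  x 0 * y 0 + x 1 * y 1 + x 2 * y 2 + x 3 * y 3 - x 4 * y 4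

/-- The hyperbolic space `H⁴`: the upper sheet of the hyperboloid `⟨x, x⟩ = -1`. -/
def H4 : Set R51 := {x | lor x x = -1 ∧ 0 < x 4}

/-! ### Tangent vectors and geodesics of submanifolds of `ℝ⁵₁` -/

/-- The tangent vectors of `S` at `p`: velocities of smooth curves in `S` through `p`. -/
def tangentVectors (S : Set R51) (p : R51) : Set R51 :=
  {v | ∃ c : ℝ → R51, ContDiff ℝ ∞ c ∧ c 0 = p ∧ (∀ᶠ t in nhds 0, c t ∈ S) ∧ deriv c 0 = v}

/-- A geodesic `ℝ → S` for the metric induced on `S` by the Lorentzian scalar product: a smooth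
curve in `S` whose covariant acceleration, i.e. the tangential part of its acceleration in `ℝ⁵₁`,
vanishes. -/
structure IsGeodesic (S : Set R51) (γ : ℝ → R51) : Prop where
  smooth : ContDiff ℝ ∞ γ
  mem : ∀ t, γ t ∈ S
  acceleration : ∀ t, ∀ w ∈ tangentVectors S (γ t), lor (deriv (deriv γ) t) w = 0

/-- (Geodesic) completeness: through every point and in every tangent direction there is a
geodesic that is defined on all of `ℝ`. -/
def IsCompleteSubmanifold (S : Set R51) : Prop :=
  ∀ p ∈ S, ∀ v ∈ tangentVectors S p, ∃ γ : ℝ → R51, IsGeodesic S γ ∧ γ 0 = p ∧ deriv γ 0 = v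

/-- The hyperboloid has its usual geodesics in the sense above; in particular there are geodesics
`ℝ → H⁴` with any given unit tangent vector as initial velocity. -/
theorem isGeodesic_H4 {p v : R51} (hp : p ∈ H4) (hpv : lor p v = 0) (hv : lor v v = 1) :
    IsGeodesic H4 (fun t => Real.cosh t • p + Real.sinh t • v) ∧
      deriv (fun t => Real.cosh t • p + Real.sinh t • v) 0 = v := by
  have d1 : ∀ (a b : R51) (t : ℝ), HasDerivAt (fun t => Real.cosh t • a + Real.sinh t • b)
      (Real.cosh t • b + Real.sinh t • a) t := by
    intro a b t
    have := ((Real.hasDerivAt_cosh t).smul_const a).add ((Real.hasDerivAt_sinh t).smul_const b)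
    rw [add_comm (Real.sinh t • a)] at this
    exact this
  have d1' : ∀ a b : R51, deriv (fun t => Real.cosh t • a + Real.sinh t • b) =
      fun t => Real.cosh t • b + Real.sinh t • a := fun a b => funext fun t => (d1 a b t).deriv
  have key : ∀ (c : ℝ → R51), ContDiff ℝ ∞ c → (∀ᶠ t in nhds 0, c t ∈ H4) →
      lor (c 0) (deriv c 0) = 0 := by
    intro c hc hmem
    have hd : ∀ k, HasDerivAt (fun t => c t k) (deriv c 0 k) 0 :=
      hasDerivAt_pi.1 (hc.differentiable (by simp) 0).hasDerivAt
    have h := (((((hd 0).mul (hd 0)).add ((hd 1).mul (hd 1))).add ((hd 2).mul (hd 2))).add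
      ((hd 3).mul (hd 3))).sub ((hd 4).mul (hd 4))
    have h0 := h.unique ((hasDerivAt_const (0 : ℝ) (-1 : ℝ)).congr_of_eventuallyEq
      (hmem.mono fun t ht => ht.1))
    simp only [lor]
    linarith
  refine ⟨⟨?_, ?_, ?_⟩, ?_⟩
  · exact (Real.contDiff_cosh.smul contDiff_const).add (Real.contDiff_sinh.smul contDiff_const)
  · intro t
    obtain ⟨hp1, hp4⟩ := hp
    have hcs := Real.cosh_sq t
    have hc := Real.cosh_pos t
    simp only [lor] at hp1 hpv hv
    constructor
    · simp only [lor, Pi.add_apply, Pi.smul_apply, smul_eq_mul]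
      linear_combination Real.cosh t ^ 2 * hp1 + 2 * Real.cosh t * Real.sinh t * hpv
        + Real.sinh t ^ 2 * hv - hcs
    · simp only [Pi.add_apply, Pi.smul_apply, smul_eq_mul]
      have hlt : v 4 ^ 2 < p 4 ^ 2 := by
        have l : (p 4 * v 4) ^ 2 ≤ (p 4 ^ 2 - 1) * (1 + v 4 ^ 2) := by
          have e1 : p 4 * v 4 = p 0 * v 0 + p 1 * v 1 + p 2 * v 2 + p 3 * v 3 := by linarith
          have e2 : p 4 ^ 2 - 1 = p 0 ^ 2 + p 1 ^ 2 + p 2 ^ 2 + p 3 ^ 2 := by nlinarith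
          have e3 : 1 + v 4 ^ 2 = v 0 ^ 2 + v 1 ^ 2 + v 2 ^ 2 + v 3 ^ 2 := by nlinarith
          rw [e1, e2, e3]
          nlinarith [sq_nonneg (p 0 * v 1 - p 1 * v 0), sq_nonneg (p 0 * v 2 - p 2 * v 0),
            sq_nonneg (p 0 * v 3 - p 3 * v 0), sq_nonneg (p 1 * v 2 - p 2 * v 1),
            sq_nonneg (p 1 * v 3 - p 3 * v 1), sq_nonneg (p 2 * v 3 - p 3 * v 2)]
        nlinarith
      have habs : |Real.sinh t * v 4| < Real.cosh t * p 4 := by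
        refine abs_lt_of_sq_lt_sq ?_ (by positivity)
        rw [mul_pow, mul_pow, hcs]
        nlinarith [sq_nonneg (Real.sinh t), mul_nonneg (sq_nonneg (Real.sinh t)) (sub_nonneg.2 hlt.le),
          sq_pos_of_pos hp4]
      have := (abs_lt.1 habs).1
      linarith
  · rintro t w ⟨c, hc, hc0, hmem, rfl⟩
    have := key c hc hmem
    rw [hc0] at this
    rw [d1', d1']
    exact this
  · rw [d1']
    simp

/-! ### Harmonic functions and harmonic morphisms on `H⁴` -/

/-- `f` is harmonic on the (relatively open) subset `W` of `H⁴`: it is `C²` there and its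
Laplace-Beltrami operator vanishes. The latter is the trace of the Hessian, and
`Hess f (v, v) = (f ∘ γ)''(0)` for the geodesic `γ` of `H⁴` with initial velocity `v`; the trace
is taken over orthonormal bases of the tangent space of `H⁴`. -/
def IsHarmonicOnH4 (f : R51 → ℝ) (W : Set R51) : Prop :=
  ContDiffOn ℝ 2 f W ∧
    ∀ p ∈ W, ∀ γ : Fin 4 → ℝ → R51,
      (∀ i, IsGeodesic H4 (γ i) ∧ γ i 0 = p) →
      (∀ i j, lor (deriv (γ i) 0) (deriv (γ j) 0) = if i = j then 1 else 0) →
      ∑ i, deriv (deriv (fun t => f (γ i t))) 0 = 0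

/-- `Φ : H⁴ → ℂ` is a harmonic morphism: it is smooth and pulls harmonic functions on open subsets
of `ℂ` back to harmonic functions. -/
def IsHarmonicMorphismH4 (Φ : R51 → ℂ) : Prop :=
  ContDiffOn ℝ ∞ Φ H4 ∧
    ∀ (U : Set ℂ) (f : ℂ → ℝ), IsOpen U → InnerProductSpace.HarmonicOnNhd f U →
      IsHarmonicOnH4 (fun x => f (Φ x)) {x ∈ H4 | Φ x ∈ U}

/-! ### Minimal surfaces in `H⁴` -/

/-- The partial derivative `∂ᵢψ`. -/
def pd (ψ : (Fin 2 → ℝ) → R51) (i : Fin 2) (u : Fin 2 → ℝ) : R51 :=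
  fderiv ℝ ψ u (Pi.single i 1)

/-- `ψ`, restricted to `D`, is a smooth local parametrization of the surface `S`. -/
structure IsLocalParam (S : Set R51) (D : Set (Fin 2 → ℝ)) (ψ : (Fin 2 → ℝ) → R51) : Prop where
  isOpen : IsOpen D
  smooth : ContDiffOn ℝ ∞ ψ D
  immersion : ∀ u ∈ D, Function.Injective (fderiv ℝ ψ u)
  embedding : Topology.IsEmbedding (D.domRestrict ψ)
  image : ∃ V : Set R51, IsOpen V ∧ ψ '' D = S ∩ V

/-- `S` is a smooth embedded two-dimensional submanifold. -/
def IsEmbeddedSurface (S : Set R51) : Prop :=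
  ∀ p ∈ S, ∃ D ψ, IsLocalParam S D ψ ∧ p ∈ ψ '' D

/-- The matrix of the first fundamental form. -/
def firstFundamentalForm (ψ : (Fin 2 → ℝ) → R51) (u : Fin 2 → ℝ) : Matrix (Fin 2) (Fin 2) ℝ :=
  Matrix.of fun i j => lor (pd ψ i u) (pd ψ j u)

/-- The mean curvature vector in `H⁴` of the parametrized surface `ψ` vanishes at `u`: the trace
`∑ gⁱʲ ⟨∂ᵢ∂ⱼψ, ν⟩` of the second fundamental form is zero for every `ν` that is tangent to `H⁴`
(orthogonal to `ψ u`) and normal to the surface. -/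
def MeanCurvatureVanishesAt (ψ : (Fin 2 → ℝ) → R51) (u : Fin 2 → ℝ) : Prop :=
  ∀ ν : R51, lor (ψ u) ν = 0 → (∀ k, lor (pd ψ k u) ν = 0) →
    ∑ i, ∑ j, (firstFundamentalForm ψ u)⁻¹ i j * lor (pd (pd ψ j) i u) ν = 0

/-- `S` is a minimal surface in `H⁴`: an embedded surface whose mean curvature vector vanishes.
It need not be connected. -/
structure IsMinimalSurfaceH4 (S : Set R51) : Prop where
  nonempty : S.Nonempty
  subset : S ⊆ H4
  embedded : IsEmbeddedSurface S
  minimal : ∀ D ψ, IsLocalParam S D ψ → ∀ u ∈ D, MeanCurvatureVanishesAt ψ u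

/-! ### The functions `P` and `Q` -/

/-- The quadratic form with symmetric matrix
`!![a₁, b₁, b₂; b₁, a₂ - a₁, b₃; b₂, b₃, -a₂]` in `x₁, x₂, x₃`. -/
def quadP (a₁ a₂ b₁ b₂ b₃ : ℂ) (x : R51) : ℂ :=
  a₁ * ((x 0 : ℂ) ^ 2 - (x 1 : ℂ) ^ 2) + a₂ * ((x 1 : ℂ) ^ 2 - (x 2 : ℂ) ^ 2)
    + 2 * b₁ * ((x 0 : ℂ) * (x 1 : ℂ)) + 2 * b₂ * ((x 0 : ℂ) * (x 2 : ℂ))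
    + 2 * b₃ * ((x 1 : ℂ) * (x 2 : ℂ))

/-- `Q = (x₄ - x₅)²`. -/
def quadQ (x : R51) : ℂ := ((x 3 : ℂ) - (x 4 : ℂ)) ^ 2

end

/-!
Put `ξ = (a₁, b₁, b₂)`. The relations say that `ξ` is isotropic, `ξ₁² + ξ₂² + ξ₃² = 0`, and that
`a₁ P = ℓ²` for the form `ℓ = ∑ ξᵢ xᵢ`, while `Q = m²` for `m = x₅ - x₄`. So `Φ*` is `ℓ / m`
followed by the entire function `z ↦ z² / a₁`, and it suffices to see that `ℓ / m` is a harmonic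
morphism. Along a geodesic of `H⁴` with speed `s` both `ℓ` and `m` satisfy `k'' = s² k`, so their
Wronskian is constant. As `ℓ` and `m` span a totally isotropic space of forms, summing over an
orthonormal frame of geodesics then kills both `∑ ((ℓ / m)')²` and `∑ (ℓ / m)''`.

The fibre over `α` is the union of `H⁴ ∩ ker (ℓ - c m)` and `H⁴ ∩ ker (ℓ + c m)` with `c² = a₁ α`.
Isotropy of `ξ ≠ 0` makes `ℓ` surjective onto `ℂ` already on `ℝ³`, so these kernels are
three-dimensional and meet `H⁴` in totally geodesic hyperbolic planes.
-/

open Module Filter InnerProductSpace Topology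
open scoped ComplexConjugate

/-! ### The Lorentzian scalar product -/

/-- The Lorentzian scalar product as a bilinear form, which gives access to Mathlib's bilinear
algebra. -/
def lorForm : LinearMap.BilinForm ℝ R51 :=
  LinearMap.mk₂ ℝ lor (fun x y z => by simp only [lor, Pi.add_apply]; ring)
    (fun r x y => by simp only [lor, Pi.smul_apply, smul_eq_mul]; ring)
    (fun x y z => by simp only [lor, Pi.add_apply]; ring)
    (fun r x y => by simp only [lor, Pi.smul_apply, smul_eq_mul]; ring)

theorem lorForm_apply (x y : R51) : lorForm x y = lor x y := rfl

theorem lor_comm (x y : R51) : lor x y = lor y x := by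
  simp only [lor]; ring

theorem lor_add_right (x y z : R51) : lor x (y + z) = lor x y + lor x z :=
  map_add (lorForm x) y z

theorem lor_add_left (x y z : R51) : lor (x + y) z = lor x z + lor y z :=
  LinearMap.map_add₂ lorForm x y z

theorem lor_smul_right (r : ℝ) (x y : R51) : lor x (r • y) = r * lor x y :=
  map_smul (lorForm x) r y

theorem lor_smul_left (r : ℝ) (x y : R51) : lor (r • x) y = r * lor x y :=
  LinearMap.map_smul₂ lorForm r x y

theorem lor_neg_right (x y : R51) : lor x (-y) = -lor x y :=
  map_neg (lorForm x) y

theorem lor_sum_left {ι : Type*} (s : Finset ι) (x : ι → R51) (y : R51) :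
    lor (∑ i ∈ s, x i) y = ∑ i ∈ s, lor (x i) y :=
  LinearMap.map_sum₂ lorForm s x y

theorem lor_sum_right {ι : Type*} (s : Finset ι) (x : R51) (y : ι → R51) :
    lor x (∑ i ∈ s, y i) = ∑ i ∈ s, lor x (y i) :=
  map_sum (lorForm x) y s

theorem sum_lor_single_smul (x : R51) :
    ∑ k, (lor (Pi.single k 1) (Pi.single k 1) * lor x (Pi.single k 1)) • Pi.single k 1 = x := by
  ext j
  fin_cases j <;> simp [lor, Pi.single_apply]

theorem eq_zero_of_forall_lor_eq_zero {x : R51} (h : ∀ y, lor x y = 0) : x = 0 := by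
  simpa only [h, mul_zero, zero_smul, Finset.sum_const_zero, eq_comm] using sum_lor_single_smul x

theorem lor_add_mul_sq_le (x y : R51) :
    (lor x y + x 4 * y 4) ^ 2 ≤ (lor x x + x 4 ^ 2) * (lor y y + y 4 ^ 2) := by
  have h := Finset.sum_mul_sq_le_sq_mul_sq Finset.univ (fun i : Fin 4 => x i.castSucc)
    (fun i => y i.castSucc)
  simpa [Fin.sum_univ_four, lor, ← sq] using h

theorem lor_self_pos {p v : R51} (hp : p ∈ H4) (hpv : lor p v = 0) (hv : v ≠ 0) :
    0 < lor v v := by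
  have hcs := lor_add_mul_sq_le p v
  rw [hpv, hp.1] at hcs
  contrapose! hv with hle
  have hspace : lor v v + v 4 ^ 2 = v 0 ^ 2 + v 1 ^ 2 + v 2 ^ 2 + v 3 ^ 2 := by
    rw [lor]; ring
  have hspace_le : lor v v + v 4 ^ 2 ≤ p 4 ^ 2 * lor v v := by linarith
  have hnonneg : 0 ≤ lor v v := by
    refine nonneg_of_mul_nonneg_right (hspace_le.trans' ?_) (pow_pos hp.2 2)
    rw [hspace]
    positivity
  ext k
  refine pow_eq_zero_iff two_ne_zero |>.1 (le_antisymm ?_ (sq_nonneg (v k)))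
  match k with
  | 0 | 1 | 2 | 3 | 4 =>
    nlinarith [sq_nonneg (v 0), sq_nonneg (v 1), sq_nonneg (v 2), sq_nonneg (v 3)]

theorem lor_neg_of_mem_H4 {p q : R51} (hp : p ∈ H4) (hq : q ∈ H4) : lor p q < 0 := by
  have hcs := lor_add_mul_sq_le p q
  rw [hp.1, hq.1] at hcs
  have hlt : (lor p q + p 4 * q 4) ^ 2 < (p 4 * q 4) ^ 2 := by
    have hq1 : 1 ≤ q 4 ^ 2 := by
      have := hq.1
      rw [lor] at this
      nlinarith [sq_nonneg (q 0), sq_nonneg (q 1), sq_nonneg (q 2), sq_nonneg (q 3)]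
    nlinarith [pow_pos hp.2 2]
  linarith [lt_of_pow_lt_pow_left₀ 2 (mul_pos hp.2 hq.2).le hlt]

theorem mem_H4_of_lor_neg {p x : R51} (hp : p ∈ H4) (hx : lor x x = -1) (hpx : lor p x < 0) :
    x ∈ H4 := by
  refine ⟨hx, ?_⟩
  by_contra! hle
  have hne : x 4 ≠ 0 := fun h => by
    have : 0 ≤ lor x x := by rw [lor, h]; nlinarith [sq_nonneg (x 0)]
    linarith
  have hmem : -x ∈ H4 :=
    ⟨by simpa [lor] using hx, neg_pos.2 (lt_of_le_of_ne hle hne)⟩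
  linarith [lor_neg_of_mem_H4 hp hmem, lor_neg_right p x]

/-- The family `v` is orthonormal for the Lorentzian scalar product and orthogonal to `p`; for
`p ∈ H⁴` this is an orthonormal family in the tangent space of `H⁴` at `p`. -/
structure IsTangentFrame {ι : Type*} [DecidableEq ι] (p : R51) (v : ι → R51) : Prop where
  lor_base : ∀ i, lor p (v i) = 0
  lor_frame : ∀ i j, lor (v i) (v j) = if i = j then 1 else 0

namespace IsTangentFrame

variable {ι : Type*} [DecidableEq ι] {p : R51} {v : ι → R51}

theorem linearIndependent (hv : IsTangentFrame p v) (hp : lor p p = -1) :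
    LinearIndependent ℝ (fun o : Option ι => o.elim p v) := by
  refine LinearMap.linearIndependent_of_isOrthoᵢ (B := lorForm) ?_ ?_
  · rintro (_ | i) (_ | j) hij
    · exact absurd rfl hij
    · exact hv.lor_base j
    · exact (lor_comm _ _).trans (hv.lor_base i)
    · exact (hv.lor_frame i j).trans (if_neg fun h => hij (congrArg some h))
  · rintro (_ | i)
    · simp [lorForm_apply, hp]
    · simp [lorForm_apply, hv.lor_frame]

theorem sum_lor_smul_sub [Fintype ι] (hv : IsTangentFrame p v) (hp : lor p p = -1)
    {W : Submodule ℝ R51} (hW : finrank ℝ W = Fintype.card ι + 1) (hpW : p ∈ W)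
    (hvW : ∀ i, v i ∈ W) {x : R51} (hx : x ∈ W) :
    ∑ i, lor (v i) x • v i - lor p x • p = x := by
  have hspan : Submodule.span ℝ (Set.range fun o : Option ι => o.elim p v) = W := by
    refine Submodule.eq_of_le_of_finrank_eq (Submodule.span_le.2 ?_) ?_
    · rintro _ ⟨_ | i, rfl⟩
      exacts [hpW, hvW i]
    · rw [finrank_span_eq_card (hv.linearIndependent hp), Fintype.card_option, hW]
  rw [← hspan, Submodule.mem_span_range_iff_exists_fun] at hx
  obtain ⟨c, rfl⟩ := hx
  have hcoord : ∀ i, lor (v i) p = 0 := fun i => (lor_comm _ _).trans (hv.lor_base i)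
  simp [Fintype.sum_option, lor_add_right, lor_smul_right, lor_sum_right, hv.lor_base,
    hv.lor_frame, hcoord, hp, add_comm]

end IsTangentFrame

theorem exists_isTangentFrame {p : R51} (hp : p ∈ H4) {W : Submodule ℝ R51} (hpW : p ∈ W)
    {n : ℕ} (hW : finrank ℝ W = n + 1) :
    ∃ v : Fin n → R51, IsTangentFrame p v ∧ ∀ i, v i ∈ W := by
  set φ : Dual ℝ W := lorForm p ∘ₗ W.subtype
  have hφ0 : φ ≠ 0 := fun h => by
    have := LinearMap.congr_fun h ⟨p, hpW⟩
    have : lor p p = 0 := this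
    linarith [hp.1]
  have hrank : finrank ℝ (LinearMap.ker φ) = n := by
    have := Dual.finrank_ker_add_one_of_ne_zero hφ0
    omega
  have hsymm : LinearMap.IsSymm ((lorForm.restrict W).restrict (LinearMap.ker φ)) :=
    ⟨fun x y => lor_comm (x : R51) y⟩
  obtain ⟨b, hb⟩ := LinearMap.BilinForm.exists_orthogonal_basis (V := LinearMap.ker φ) hsymm
  subst hrank
  have hpos : ∀ i, 0 < lor (b i) (b i) := fun i =>
    lor_self_pos hp (b i).2 (by simpa using b.ne_zero i)
  refine ⟨fun i => (√(lor (b i) (b i)))⁻¹ • (b i : R51), ⟨fun i => ?_, fun i j => ?_⟩,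
    fun i => W.smul_mem _ (b i).1.2⟩
  · rw [lor_smul_right, show lor p (b i) = 0 from (b i).2, mul_zero]
  · rw [lor_smul_left, lor_smul_right]
    split_ifs with hij
    · rw [← hij, ← mul_assoc, ← mul_inv, Real.mul_self_sqrt (hpos i).le,
        inv_mul_cancel₀ (hpos i).ne']
    · rw [show lor (b i) (b j) = 0 from hb hij, mul_zero, mul_zero]

/-- The complex bilinear extension to complex-valued forms of the scalar product dual to `lor`,
i.e. `∑ εₖ ℓ(eₖ) m(eₖ)` over the standard basis with signs `εₖ = ⟨eₖ, eₖ⟩`. A form `ℓ` is isotropic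
if `lorDual ℓ ℓ = 0`. -/
noncomputable def lorDual (ℓ m : R51 →L[ℝ] ℂ) : ℂ :=
  ∑ k, lor (Pi.single k 1) (Pi.single k 1) • (ℓ (Pi.single k 1) * m (Pi.single k 1))

theorem IsTangentFrame.sum_mul_apply {p : R51} {v : Fin 4 → R51} (hv : IsTangentFrame p v)
    (hp : lor p p = -1) (ℓ m : R51 →L[ℝ] ℂ) :
    ∑ i, ℓ (v i) * m (v i) = lorDual ℓ m + ℓ p * m p := by
  have hexpand : ∀ x, ℓ x = ∑ i, lor (v i) x • ℓ (v i) - lor p x • ℓ p := fun x => by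
    conv_lhs => rw [← hv.sum_lor_smul_sub hp (W := ⊤) (by simp) trivial (fun _ => trivial)
      (Submodule.mem_top (x := x))]
    simp only [map_sub, map_sum, map_smul]
  have hm : ∀ x : R51, ∑ k, lor (Pi.single k 1) (Pi.single k 1) •
      (lor x (Pi.single k 1) • m (Pi.single k 1)) = m x := fun x => by
    conv_rhs => rw [← sum_lor_single_smul x]
    simp only [map_sum, map_smul, smul_smul]
  have hdual : lorDual ℓ m = ∑ i, ℓ (v i) * m (v i) - ℓ p * m p := by
    calc lorDual ℓ m
        = ∑ k, (∑ i, ℓ (v i) * (lor (Pi.single k 1) (Pi.single k 1) •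
            (lor (v i) (Pi.single k 1) • m (Pi.single k 1))) - ℓ p *
              (lor (Pi.single k 1) (Pi.single k 1) •
                (lor p (Pi.single k 1) • m (Pi.single k 1)))) := by
          refine Finset.sum_congr rfl fun k _ => ?_
          rw [hexpand (Pi.single k 1)]
          simp only [sub_mul, Finset.sum_mul, smul_sub, Finset.smul_sum, mul_smul_comm,
            smul_mul_assoc]
      _ = ∑ i, ℓ (v i) * m (v i) - ℓ p * m p := by
          rw [Finset.sum_sub_distrib, Finset.sum_comm]
          simp only [← Finset.mul_sum, hm]
  rw [hdual, sub_add_cancel]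

/-! ### Geodesics of `H⁴` -/

theorem hasDerivAt_lor {x y : ℝ → R51} {x' y' : R51} {t : ℝ} (hx : HasDerivAt x x' t)
    (hy : HasDerivAt y y' t) :
    HasDerivAt (fun s => lor (x s) (y s)) (lor x' (y t) + lor (x t) y') t := by
  have hx := hasDerivAt_pi.1 hx
  have hy := hasDerivAt_pi.1 hy
  have h := (((((hx 0).mul (hy 0)).add ((hx 1).mul (hy 1))).add ((hx 2).mul (hy 2))).add
    ((hx 3).mul (hy 3))).sub ((hx 4).mul (hy 4))
  refine h.congr_deriv ?_
  simp only [lor]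
  ring

theorem lor_fderiv_eq_zero {E : Type*} [NormedAddCommGroup E] [NormedSpace ℝ E] {g : E → R51}
    {u : E} (hg : DifferentiableAt ℝ g u) (hmem : ∀ᶠ x in 𝓝 u, g x ∈ H4) (e : E) :
    lor (g u) (fderiv ℝ g u e) = 0 := by
  have hline : HasDerivAt (fun t : ℝ => g (u + t • e)) (fderiv ℝ g u e) 0 :=
    hg.hasFDerivAt.hasLineDerivAt e
  have hmem_line : ∀ᶠ t : ℝ in 𝓝 0, g (u + t • e) ∈ H4 := by
    have hcont : ContinuousAt (fun t : ℝ => u + t • e) 0 := by fun_prop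
    exact hcont.eventually (by simpa using hmem)
  have h := (hasDerivAt_lor hline hline).unique
    ((hasDerivAt_const 0 (-1 : ℝ)).congr_of_eventuallyEq (hmem_line.mono fun t ht => ht.1))
  rw [lor_comm (fderiv ℝ g u e), zero_smul, add_zero] at h
  linarith

theorem lor_deriv_eq_zero {c : ℝ → R51} {t : ℝ} (hc : DifferentiableAt ℝ c t)
    (hmem : ∀ᶠ s in 𝓝 t, c s ∈ H4) : lor (c t) (deriv c t) = 0 := by
  rw [← fderiv_apply_one_eq_deriv]
  exact lor_fderiv_eq_zero hc hmem 1

theorem fderiv_apply_mem_of_eventually_mem {E F : Type*} [NormedAddCommGroup E]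
    [NormedSpace ℝ E] [NormedAddCommGroup F] [NormedSpace ℝ F] {W : Submodule ℝ F}
    (hW : IsClosed (W : Set F)) {g : E → F} {u : E} (hg : ∀ᶠ x in 𝓝 u, g x ∈ W) (e : E) :
    fderiv ℝ g u e ∈ W := by
  by_cases hdiff : DifferentiableAt ℝ g u
  · have hcont : Tendsto (fun t : ℝ => u + t • e) (𝓝[≠] 0) (𝓝 u) :=
      (Continuous.tendsto' (by fun_prop) _ _ (by simp)).mono_left nhdsWithin_le_nhds
    refine hW.mem_of_tendsto (hdiff.hasFDerivAt.hasLineDerivAt e).tendsto_slope_zero ?_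
    filter_upwards [hcont.eventually hg] with t ht
    exact W.smul_mem _ (W.sub_mem ht hg.self_of_nhds)
  · rw [fderiv_zero_of_not_differentiableAt hdiff]
    exact W.zero_mem

namespace IsGeodesic

variable {S T : Set R51} {γ : ℝ → R51}

theorem const {p : R51} (hp : p ∈ S) : IsGeodesic S fun _ => p where
  smooth := contDiff_const
  mem _ := hp
  acceleration t w _ := by simp [lor]

theorem comp_mul_left (hγ : IsGeodesic S γ) (s : ℝ) : IsGeodesic S fun t => γ (s * t) where
  smooth := hγ.smooth.comp (contDiff_const.mul contDiff_id)
  mem t := hγ.mem (s * t)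
  acceleration t w hw := by
    have hderiv : deriv (fun t => γ (s * t)) = fun t => s • deriv γ (s * t) :=
      funext fun t => deriv_comp_mul_left s γ t
    rw [hderiv, deriv_fun_const_smul_field, deriv_comp_mul_left, lor_smul_left, lor_smul_left,
      hγ.acceleration _ w hw, mul_zero, mul_zero]

theorem of_subset (hγ : IsGeodesic T γ) (hST : S ⊆ T) (hmem : ∀ t, γ t ∈ S) : IsGeodesic S γ where
  smooth := hγ.smooth
  mem := hmem
  acceleration := by
    rintro t _ ⟨c, hc, hc0, hcS, rfl⟩
    exact hγ.acceleration t _ ⟨c, hc, hc0, hcS.mono fun _ h => hST h, rfl⟩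

end IsGeodesic

theorem exists_isGeodesic_H4 {p v : R51} (hp : p ∈ H4) (hpv : lor p v = 0) {W : Submodule ℝ R51}
    (hpW : p ∈ W) (hvW : v ∈ W) :
    ∃ γ : ℝ → R51, IsGeodesic H4 γ ∧ γ 0 = p ∧ deriv γ 0 = v ∧ ∀ t, γ t ∈ W := by
  rcases eq_or_ne v 0 with rfl | hv
  · exact ⟨fun _ => p, .const hp, rfl, deriv_const 0 p, fun _ => hpW⟩
  set s := √(lor v v)
  have hs : s ≠ 0 := (Real.sqrt_pos.2 (lor_self_pos hp hpv hv)).ne'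
  have hss : s * s = lor v v := Real.mul_self_sqrt (lor_self_pos hp hpv hv).le
  obtain ⟨hgeo, hderiv⟩ := isGeodesic_H4 hp (v := s⁻¹ • v) (by rw [lor_smul_right, hpv, mul_zero])
    (by rw [lor_smul_left, lor_smul_right, ← hss]; field_simp)
  refine ⟨_, hgeo.comp_mul_left s, by simp, ?_, fun t => ?_⟩
  · rw [deriv_comp_mul_left s (fun t => Real.cosh t • p + Real.sinh t • s⁻¹ • v), mul_zero, hderiv,
      smul_inv_smul₀ hs]
  · exact W.add_mem (W.smul_mem _ hpW) (W.smul_mem _ (W.smul_mem _ hvW))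

theorem mem_tangentVectors_H4_iff {p v : R51} (hp : p ∈ H4) :
    v ∈ tangentVectors H4 p ↔ lor p v = 0 := by
  constructor
  · rintro ⟨c, hc, rfl, hmem, rfl⟩
    exact lor_deriv_eq_zero (hc.differentiable (by simp) 0) hmem
  · intro hpv
    obtain ⟨γ, hγ, h0, h1, -⟩ := exists_isGeodesic_H4 hp hpv (W := ⊤) trivial trivial
    exact ⟨γ, hγ.smooth, h0, .of_forall hγ.mem, h1⟩

theorem eq_neg_lor_smul {p a : R51} (hp : lor p p = -1)
    (ha : ∀ w, lor p w = 0 → lor a w = 0) : a = -lor a p • p := by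
  rw [neg_smul, ← add_eq_zero_iff_eq_neg]
  refine eq_zero_of_forall_lor_eq_zero fun y => ?_
  have h := ha (y + lor p y • p) (by rw [lor_add_right, lor_smul_right, hp]; ring)
  rw [lor_add_right, lor_smul_right] at h
  rw [lor_add_left, lor_smul_left, mul_comm, h]

theorem IsGeodesic.deriv_deriv_eq {γ : ℝ → R51} (hγ : IsGeodesic H4 γ) (t : ℝ) :
    deriv (deriv γ) t = lor (deriv γ t) (deriv γ t) • γ t := by
  have hd : Differentiable ℝ γ := hγ.smooth.differentiable (by simp)
  have hdd : Differentiable ℝ (deriv γ) :=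
    (contDiff_infty_iff_deriv.1 hγ.smooth).2.differentiable (by simp)
  have horth : ∀ t, lor (γ t) (deriv γ t) = 0 := fun t =>
    lor_deriv_eq_zero (hd t) (.of_forall hγ.mem)
  have hderiv := (hasDerivAt_lor (hd t).hasDerivAt (hdd t).hasDerivAt).unique
    ((hasDerivAt_const t (0 : ℝ)).congr_of_eventuallyEq (.of_forall horth))
  rw [eq_neg_lor_smul (hγ.mem t).1 fun w hw =>
    hγ.acceleration t w ((mem_tangentVectors_H4_iff (hγ.mem t)).2 hw)]
  congr 1
  rw [lor_comm]
  linarith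


/-! ### Totally geodesic submanifolds of `H⁴` -/

/-- `S` is a union of totally geodesic hyperbolic `d`-spaces `H⁴ ∩ W`, with `W` linear of dimension
`d + 1`, each of them relatively open in `S`. The spaces are not indexed: the one through `p` is
required to be all of `S` near `p`. -/
def IsUnionOfHyperbolicSubspaces (d : ℕ) (S : Set R51) : Prop :=
  ∀ p ∈ S, ∃ W : Submodule ℝ R51, finrank ℝ W = d + 1 ∧
    ∃ V : Set R51, IsOpen V ∧ p ∈ V ∧ S ∩ V = H4 ∩ W

section HyperboloidParam

/-- The parametrization of `H⁴ ∩ span (p, v)` as the graph of `u ↦ √(1 + |u|²)` in the coordinates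
given by `p ∈ H⁴` and an orthonormal tangent frame `v` at `p`. -/
noncomputable def hyperboloidParam {ι : Type*} [Fintype ι] (p : R51) (v : ι → R51) (u : ι → ℝ) :
    R51 :=
  √(1 + ∑ i, u i ^ 2) • p + ∑ i, u i • v i

variable {ι : Type*} [Fintype ι] {p : R51} {v : ι → R51}

theorem contDiff_hyperboloidParam {n : WithTop ℕ∞} : ContDiff ℝ n (hyperboloidParam p v) := by
  have hsqrt : ContDiff ℝ n fun u : ι → ℝ => √(1 + ∑ i, u i ^ 2) :=
    ContDiff.sqrt (by fun_prop) fun u => by positivity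
  unfold hyperboloidParam
  fun_prop

theorem hyperboloidParam_mem {W : Submodule ℝ R51} (hpW : p ∈ W) (hvW : ∀ i, v i ∈ W)
    (u : ι → ℝ) : hyperboloidParam p v u ∈ W :=
  W.add_mem (W.smul_mem _ hpW) (W.sum_mem fun i _ => W.smul_mem _ (hvW i))

namespace IsTangentFrame

variable [DecidableEq ι] (hv : IsTangentFrame p v)
include hv

theorem lor_hyperboloidParam (i : ι) (u : ι → ℝ) : lor (v i) (hyperboloidParam p v u) = u i := by
  simp [hyperboloidParam, lor_add_right, lor_smul_right, lor_sum_right, hv.lor_frame,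
    (lor_comm _ _).trans (hv.lor_base i)]

theorem lor_base_hyperboloidParam (hp : lor p p = -1) (u : ι → ℝ) :
    lor p (hyperboloidParam p v u) = -√(1 + ∑ i, u i ^ 2) := by
  simp [hyperboloidParam, lor_add_right, lor_smul_right, lor_sum_right, hv.lor_base, hp]

theorem hyperboloidParam_mem_H4 (hp : p ∈ H4) (u : ι → ℝ) : hyperboloidParam p v u ∈ H4 := by
  have hpos : 0 < 1 + ∑ i, u i ^ 2 := by positivity
  have hbase := hv.lor_base_hyperboloidParam hp.1 u
  refine mem_H4_of_lor_neg hp ?_ (by rw [hbase]; exact neg_neg_of_pos (Real.sqrt_pos.2 hpos))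
  calc lor (hyperboloidParam p v u) (hyperboloidParam p v u)
      = √(1 + ∑ i, u i ^ 2) * lor p (hyperboloidParam p v u)
          + ∑ i, u i * lor (v i) (hyperboloidParam p v u) := by
        conv_lhs => enter [1]; rw [hyperboloidParam]
        simp only [lor_add_left, lor_sum_left, lor_smul_left]
    _ = -1 := by
        simp only [hbase, hv.lor_hyperboloidParam, mul_neg, Real.mul_self_sqrt hpos.le, ← sq]
        ring

theorem range_hyperboloidParam (hp : p ∈ H4) {W : Submodule ℝ R51}
    (hW : finrank ℝ W = Fintype.card ι + 1) (hpW : p ∈ W) (hvW : ∀ i, v i ∈ W) :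
    Set.range (hyperboloidParam p v) = H4 ∩ W := by
  refine subset_antisymm (Set.range_subset_iff.2 fun u =>
    ⟨hv.hyperboloidParam_mem_H4 hp u, hyperboloidParam_mem hpW hvW u⟩) fun x hx => ?_
  have hexpand := hv.sum_lor_smul_sub hp.1 hW hpW hvW hx.2
  have hnorm : lor p x ^ 2 = 1 + ∑ i, lor (v i) x ^ 2 := by
    have hxx : lor (∑ i, lor (v i) x • v i - lor p x • p) x = -1 := by rw [hexpand, hx.1.1]
    rw [sub_eq_add_neg, ← neg_smul] at hxx
    simp only [lor_add_left, lor_sum_left, lor_smul_left, neg_mul, ← sq] at hxx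
    linarith
  refine ⟨fun i => lor (v i) x, ?_⟩
  rw [hyperboloidParam, ← hnorm, Real.sqrt_sq_eq_abs, abs_of_neg (lor_neg_of_mem_H4 hp hx.1)]
  conv_rhs => rw [← hexpand]
  rw [neg_smul, add_comm, sub_eq_add_neg]

theorem exists_leftInverse_hyperboloidParam :
    ∃ L : R51 →L[ℝ] ι → ℝ, Function.LeftInverse L (hyperboloidParam p v) :=
  ⟨LinearMap.toContinuousLinearMap (.pi fun i => lorForm (v i)),
    fun u => funext fun i => hv.lor_hyperboloidParam i u⟩

theorem injective_fderiv_hyperboloidParam (u : ι → ℝ) :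
    Function.Injective (fderiv ℝ (hyperboloidParam p v) u) := by
  obtain ⟨L, hL⟩ := hv.exists_leftInverse_hyperboloidParam
  have hdiff : DifferentiableAt ℝ (hyperboloidParam p v) u :=
    contDiff_hyperboloidParam.differentiable one_ne_zero u
  have hderiv : L ∘L fderiv ℝ (hyperboloidParam p v) u = .id ℝ (ι → ℝ) := by
    rw [← L.fderiv (x := hyperboloidParam p v u), ← fderiv_comp u L.differentiableAt hdiff,
      hL.comp_eq_id, fderiv_id]
  exact Function.LeftInverse.injective (g := L) fun e => DFunLike.congr_fun hderiv e

theorem isEmbedding_hyperboloidParam : IsEmbedding (hyperboloidParam p v) := by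
  obtain ⟨L, hL⟩ := hv.exists_leftInverse_hyperboloidParam
  exact hL.isEmbedding L.continuous (contDiff_hyperboloidParam (n := 0)).continuous

end IsTangentFrame

end HyperboloidParam

theorem exists_eq_smul_add_fderiv {E : Type*} [NormedAddCommGroup E] [NormedSpace ℝ E]
    [FiniteDimensional ℝ E] {ψ : E → R51} {u : E} {W : Submodule ℝ R51}
    (hW : finrank ℝ W = finrank ℝ E + 1) (himm : Function.Injective (fderiv ℝ ψ u))
    (hψ : ∀ᶠ x in 𝓝 u, ψ x ∈ H4 ∩ W) {w : R51} (hw : w ∈ W) :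
    ∃ (c : ℝ) (e : E), c • ψ u + fderiv ℝ ψ u e = w := by
  have hdiff := differentiableAt_of_fderiv_injective himm
  let T : ℝ × E →ₗ[ℝ] R51 := (LinearMap.toSpanSingleton ℝ R51 (ψ u)).coprod (fderiv ℝ ψ u)
  have hT : Function.Injective T := by
    refine (injective_iff_map_eq_zero T).2 fun ⟨c, e⟩ h => ?_
    have hsum : c • ψ u + fderiv ℝ ψ u e = 0 := h
    have hc : c = 0 := by
      have hlor : lor (ψ u) (c • ψ u + fderiv ℝ ψ u e) = -c := by
        rw [lor_add_right, lor_smul_right, hψ.self_of_nhds.1.1,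
          lor_fderiv_eq_zero hdiff (hψ.mono fun x hx => hx.1)]
        ring
      rw [hsum] at hlor
      simpa [lor] using hlor
    rw [hc, zero_smul, zero_add] at hsum
    rw [hc, (map_eq_zero_iff _ himm).1 hsum, Prod.mk_zero_zero]
  have hrange : LinearMap.range T = W := by
    refine Submodule.eq_of_le_of_finrank_eq ?_ ?_
    · rintro _ ⟨⟨c, e⟩, rfl⟩
      exact W.add_mem (W.smul_mem c hψ.self_of_nhds.2)
        (fderiv_apply_mem_of_eventually_mem W.closed_of_finiteDimensional
          (hψ.mono fun x hx => hx.2) e)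
    · rw [LinearMap.finrank_range_of_inj hT, finrank_prod, finrank_self, hW, add_comm]
  obtain ⟨⟨c, e⟩, h⟩ := hrange.ge hw
  exact ⟨c, e, h⟩

theorem meanCurvatureVanishesAt_of_eventually_mem {ψ : (Fin 2 → ℝ) → R51} {u : Fin 2 → ℝ}
    {W : Submodule ℝ R51} (hW : finrank ℝ W = 3) (himm : Function.Injective (fderiv ℝ ψ u))
    (hψ : ∀ᶠ x in 𝓝 u, ψ x ∈ H4 ∩ W) :
    MeanCurvatureVanishesAt ψ u := by
  intro ν hν hνpd
  have hnormal : ∀ w ∈ W, lor w ν = 0 := by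
    intro w hw
    obtain ⟨c, e, rfl⟩ := exists_eq_smul_add_fderiv (by simpa using hW) himm hψ hw
    have he : fderiv ℝ ψ u e = e 0 • pd ψ 0 u + e 1 • pd ψ 1 u := by
      conv_lhs => rw [pi_eq_sum_univ' e]
      simp [pd]
    rw [he]
    simp [lor_add_left, lor_smul_left, hν, hνpd]
  have hpd : ∀ j, ∀ᶠ x in 𝓝 u, pd ψ j x ∈ W := fun j => hψ.eventually_nhds.mono fun x hx =>
    fderiv_apply_mem_of_eventually_mem W.closed_of_finiteDimensional (hx.mono fun _ h => h.2) _
  refine Finset.sum_eq_zero fun i _ => Finset.sum_eq_zero fun j _ => ?_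
  have hmem : pd (pd ψ j) i u ∈ W :=
    fderiv_apply_mem_of_eventually_mem W.closed_of_finiteDimensional (hpd j) _
  rw [hnormal _ hmem, mul_zero]

namespace IsUnionOfHyperbolicSubspaces

variable {S : Set R51}

theorem subset_H4 {d : ℕ} (hS : IsUnionOfHyperbolicSubspaces d S) : S ⊆ H4 := fun p hp => by
  obtain ⟨W, -, V, -, hpV, hSV⟩ := hS p hp
  exact (hSV.subset ⟨hp, hpV⟩).1

theorem isCompleteSubmanifold {d : ℕ} (hS : IsUnionOfHyperbolicSubspaces d S) :
    IsCompleteSubmanifold S := by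
  rintro p hp _ ⟨c, hc, rfl, hcS, rfl⟩
  obtain ⟨W, -, V, hV, hpV, hSV⟩ := hS _ hp
  have hcW : ∀ᶠ t in 𝓝 0, c t ∈ H4 ∩ W := by
    filter_upwards [hcS, hc.continuous.continuousAt.eventually (hV.mem_nhds hpV)] with t hS hV
    exact hSV.subset ⟨hS, hV⟩
  have hderivW : deriv c 0 ∈ W := by
    rw [← fderiv_apply_one_eq_deriv]
    exact fderiv_apply_mem_of_eventually_mem W.closed_of_finiteDimensional
      (hcW.mono fun _ h => h.2) 1
  obtain ⟨γ, hγ, hγ0, hγ', hγW⟩ := exists_isGeodesic_H4 hcW.self_of_nhds.1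
    (lor_deriv_eq_zero (hc.differentiable (by simp) 0) (hcW.mono fun _ h => h.1))
    hcW.self_of_nhds.2 hderivW
  exact ⟨γ, hγ.of_subset hS.subset_H4 fun t => (hSV.superset ⟨hγ.mem t, hγW t⟩).1, hγ0, hγ'⟩

theorem isEmbeddedSurface (hS : IsUnionOfHyperbolicSubspaces 2 S) : IsEmbeddedSurface S := by
  intro p hp
  obtain ⟨W, hW, V, hV, hpV, hSV⟩ := hS p hp
  obtain ⟨hpH, hpW⟩ := hSV.subset ⟨hp, hpV⟩
  obtain ⟨v, hv, hvW⟩ := exists_isTangentFrame hpH hpW hW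
  have hrange := hv.range_hyperboloidParam hpH (by simpa using hW) hpW hvW
  refine ⟨Set.univ, hyperboloidParam p v, ⟨isOpen_univ, contDiff_hyperboloidParam.contDiffOn,
    fun u _ => hv.injective_fderiv_hyperboloidParam u,
    hv.isEmbedding_hyperboloidParam.comp .subtypeVal, V, hV, ?_⟩, ?_⟩
  · rw [Set.image_univ, hrange, hSV]
  · rw [Set.image_univ, hrange]
    exact ⟨hpH, hpW⟩

theorem isMinimalSurfaceH4 (hS : IsUnionOfHyperbolicSubspaces 2 S) (hne : S.Nonempty) :
    IsMinimalSurfaceH4 S where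
  nonempty := hne
  subset := hS.subset_H4
  embedded := hS.isEmbeddedSurface
  minimal D ψ hψ u hu := by
    obtain ⟨V', -, himage⟩ := hψ.image
    have hψS : ∀ x ∈ D, ψ x ∈ S := fun x hx => (himage.subset ⟨x, hx, rfl⟩).1
    obtain ⟨W, hW, V, hV, huV, hSV⟩ := hS _ (hψS u hu)
    have hD : D ∈ 𝓝 u := hψ.isOpen.mem_nhds hu
    have hcont : ContinuousAt ψ u := (hψ.smooth.contDiffAt hD).continuousAt
    refine meanCurvatureVanishesAt_of_eventually_mem hW (hψ.immersion u hu) ?_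
    filter_upwards [hD, hcont.eventually (hV.mem_nhds huV)] with x hx hxV
    exact hSV.subset ⟨hψS x hx, hxV⟩

end IsUnionOfHyperbolicSubspaces

/-! ### Harmonic morphisms from `H⁴` -/

theorem harmonicAt_comp_analyticAt {f : ℂ → ℝ} {g : ℂ → ℂ} {z : ℂ} (hf : HarmonicAt f (g z))
    (hg : AnalyticAt ℂ g z) : HarmonicAt (f ∘ g) z := by
  obtain ⟨r, hr, hball⟩ := Metric.isOpen_iff.1 (isOpen_setOfPred_harmonicAt f) _ hf
  obtain ⟨F, hF, hFf⟩ := HarmonicOnNhd.exists_analyticOnNhd_ball_re_eq hball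
  have hev : (fun w => (F (g w)).re) =ᶠ[𝓝 z] f ∘ g := by
    filter_upwards [hg.continuousAt.eventually (Metric.ball_mem_nhds _ hr)] with w hw
    exact hFf hw
  have hFg : AnalyticAt ℂ (F ∘ g) z := (hF _ (Metric.mem_ball_self hr)).comp hg
  exact (harmonicAt_congr_nhds hev).1 hFg.harmonicAt_re

theorem sum_iteratedFDeriv_two_eq_zero_of_harmonicAt {f : ℂ → ℝ} {z : ℂ} (hf : HarmonicAt f z)
    {ι : Type*} {s : Finset ι} {w : ι → ℂ} (hw : ∑ i ∈ s, w i ^ 2 = 0) :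
    ∑ i ∈ s, iteratedFDeriv ℝ 2 f z (fun _ => w i) = 0 := by
  set B := fderiv ℝ (fderiv ℝ f) z with hB
  have hsymm : B Complex.I 1 = B 1 Complex.I := (hf.1.isSymmSndFDerivAt (by simp)).eq _ _
  have hlap : B 1 1 + B Complex.I Complex.I = 0 := by
    have := hf.2.self_of_nhds
    rw [laplacian_eq_iteratedFDeriv_complexPlane] at this
    simpa [iteratedFDeriv_two_apply] using this
  have hexpand : ∀ w : ℂ, iteratedFDeriv ℝ 2 f z (fun _ => w) =
      (w ^ 2).re * B 1 1 + (w ^ 2).im * B 1 Complex.I := by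
    intro w
    have hw : w = w.re • (1 : ℂ) + w.im • Complex.I := by simp [Complex.re_add_im]
    rw [iteratedFDeriv_two_apply]
    conv_lhs => rw [hw]
    simp only [map_add, map_smul, add_apply, smul_apply, smul_eq_mul, hsymm, ← hB, sq,
      Complex.mul_re, Complex.mul_im]
    linear_combination w.im * w.im * hlap
  simp only [hexpand, Finset.sum_add_distrib, ← Finset.sum_mul, ← Complex.re_sum,
    ← Complex.im_sum, hw, Complex.zero_re, Complex.zero_im, zero_mul, add_zero]

theorem deriv_deriv_comp {f : ℂ → ℝ} {φ : ℝ → ℂ} {t : ℝ} (hf : ContDiffAt ℝ 2 f (φ t))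
    (hφ : ContDiffAt ℝ 2 φ t) :
    deriv (deriv fun s => f (φ s)) t =
      iteratedFDeriv ℝ 2 f (φ t) (fun _ => deriv φ t) + fderiv ℝ f (φ t) (deriv (deriv φ) t) := by
  have h := iteratedDeriv_vcomp_two hf hφ
  rwa [iteratedDeriv_succ, iteratedDeriv_one, iteratedDeriv_succ, iteratedDeriv_one] at h

theorem isHarmonicMorphismH4_of_geodesic_frames {Φ : R51 → ℂ} (hΦ : ContDiffOn ℝ ∞ Φ H4)
    (hframe : ∀ γ : Fin 4 → ℝ → R51, ∀ p ∈ H4, (∀ i, IsGeodesic H4 (γ i) ∧ γ i 0 = p) →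
      IsTangentFrame p (fun i => deriv (γ i) 0) →
      ∑ i, deriv (Φ ∘ γ i) 0 ^ 2 = 0 ∧ ∑ i, deriv (deriv (Φ ∘ γ i)) 0 = 0) :
    IsHarmonicMorphismH4 Φ := by
  refine ⟨hΦ, fun U f _ hf => ⟨?_, fun p hp γ hγ hγv => ?_⟩⟩
  · have hfU : ContDiffOn ℝ 2 f U := fun z hz => (hf z hz).1.contDiffWithinAt
    exact hfU.comp ((hΦ.of_le (by norm_cast)).mono fun x hx => hx.1)
      fun x hx => hx.2
  have hΦγ : ∀ i, ContDiffAt ℝ 2 (Φ ∘ γ i) 0 := fun i =>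
    ((hΦ.comp_contDiff (hγ i).1.smooth (hγ i).1.mem).of_le (by norm_cast)).contDiffAt
  have hbase : ∀ i, Φ (γ i 0) = Φ p := fun i => by rw [(hγ i).2]
  have hv : IsTangentFrame p fun i => deriv (γ i) 0 := ⟨fun i => by
    rw [← (hγ i).2]
    exact lor_deriv_eq_zero ((hγ i).1.smooth.differentiable (by simp) 0)
      (.of_forall (hγ i).1.mem), hγv⟩
  obtain ⟨hconformal, hlaplacian⟩ := hframe γ p hp.1 hγ hv
  calc ∑ i, deriv (deriv fun t => f (Φ (γ i t))) 0
      = ∑ i, (iteratedFDeriv ℝ 2 f (Φ p) (fun _ => deriv (Φ ∘ γ i) 0)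
          + fderiv ℝ f (Φ p) (deriv (deriv (Φ ∘ γ i)) 0)) := by
        refine Finset.sum_congr rfl fun i _ => ?_
        rw [← hbase i]
        exact deriv_deriv_comp (by simpa [hbase i] using (hf _ hp.2).1) (hΦγ i)
    _ = 0 := by
        rw [Finset.sum_add_distrib,
          sum_iteratedFDeriv_two_eq_zero_of_harmonicAt (hf _ hp.2) hconformal, ← map_sum,
          hlaplacian, map_zero, add_zero]

theorem IsHarmonicMorphismH4.comp_differentiable {Φ : R51 → ℂ} (hΦ : IsHarmonicMorphismH4 Φ)
    {g : ℂ → ℂ} (hg : Differentiable ℂ g) : IsHarmonicMorphismH4 (g ∘ Φ) :=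
  ⟨(hg.contDiff.restrict_scalars ℝ).comp_contDiffOn hΦ.1, fun U f hU hf =>
    hΦ.2 (g ⁻¹' U) (f ∘ g) (hU.preimage hg.continuous) fun z hz =>
      harmonicAt_comp_analyticAt (hf _ hz) (hg.analyticAt z)⟩

theorem deriv_deriv_div {l m : ℝ → ℂ} {t : ℝ} (hl : ContDiff ℝ 2 l) (hm : ContDiff ℝ 2 m)
    (hm0 : ∀ s, m s ≠ 0) {κ : ℂ} (hl2 : deriv (deriv l) t = κ * l t)
    (hm2 : deriv (deriv m) t = κ * m t) :
    deriv (deriv fun s => l s / m s) t =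
      -2 * (deriv l t * m t - l t * deriv m t) * deriv m t / m t ^ 3 := by
  have hl0' : ∀ s, HasDerivAt l (deriv l s) s := fun s =>
    (hl.differentiable two_ne_zero s).hasDerivAt
  have hm0' : ∀ s, HasDerivAt m (deriv m s) s := fun s =>
    (hm.differentiable two_ne_zero s).hasDerivAt
  have hl1' : HasDerivAt (deriv l) (κ * l t) t :=
    hl2 ▸ ((contDiff_succ_iff_deriv (n := 1).1 hl).2.2.differentiable one_ne_zero t).hasDerivAt
  have hm1' : HasDerivAt (deriv m) (κ * m t) t :=
    hm2 ▸ ((contDiff_succ_iff_deriv (n := 1).1 hm).2.2.differentiable one_ne_zero t).hasDerivAt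
  have hderiv : (deriv fun s => l s / m s) =
      fun s => (deriv l s * m s - l s * deriv m s) / m s ^ 2 :=
    funext fun s => ((hl0' s).div (hm0' s) (hm0 s)).deriv
  have hwronskian : HasDerivAt (fun s => deriv l s * m s - l s * deriv m s) 0 t :=
    ((hl1'.mul (hm0' t)).sub ((hl0' t).mul hm1')).congr_deriv (by ring)
  rw [hderiv, (hwronskian.fun_div ((hm0' t).fun_pow 2) (pow_ne_zero 2 (hm0 t))).deriv]
  have := hm0 t
  field_simp
  ring

theorem deriv_continuousLinearMap_comp {E F : Type*} [NormedAddCommGroup E] [NormedSpace ℝ E]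
    [NormedAddCommGroup F] [NormedSpace ℝ F] (k : E →L[ℝ] F) {c : ℝ → E} {t : ℝ}
    (hc : DifferentiableAt ℝ c t) : deriv (fun s => k (c s)) t = k (deriv c t) :=
  (k.hasFDerivAt.comp_hasDerivAt t hc.hasDerivAt).deriv

theorem IsGeodesic.deriv_deriv_continuousLinearMap_comp {γ : ℝ → R51} (hγ : IsGeodesic H4 γ)
    (k : R51 →L[ℝ] ℂ) (t : ℝ) :
    deriv (deriv fun s => k (γ s)) t = lor (deriv γ t) (deriv γ t) * k (γ t) := by
  have hγ' : Differentiable ℝ (deriv γ) :=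
    (contDiff_infty_iff_deriv.1 hγ.smooth).2.differentiable (by simp)
  have hderiv : (deriv fun s => k (γ s)) = fun s => k (deriv γ s) :=
    funext fun s => deriv_continuousLinearMap_comp k (hγ.smooth.differentiable (by simp) s)
  rw [hderiv, deriv_continuousLinearMap_comp k (hγ' t), hγ.deriv_deriv_eq, map_smul,
    Complex.real_smul]

theorem IsGeodesic.deriv_div {γ : ℝ → R51} (hγ : IsGeodesic H4 γ) (ℓ : R51 →L[ℝ] ℂ)
    {m : R51 →L[ℝ] ℂ} {t : ℝ} (hm0 : m (γ t) ≠ 0) :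
    deriv (fun s => ℓ (γ s) / m (γ s)) t =
      (ℓ (deriv γ t) * m (γ t) - ℓ (γ t) * m (deriv γ t)) / m (γ t) ^ 2 := by
  have hd : HasDerivAt γ (deriv γ t) t := (hγ.smooth.differentiable (by simp) t).hasDerivAt
  exact ((ℓ.hasFDerivAt.comp_hasDerivAt t hd).fun_div (m.hasFDerivAt.comp_hasDerivAt t hd)
    hm0).deriv

theorem IsGeodesic.deriv_deriv_div {γ : ℝ → R51} (hγ : IsGeodesic H4 γ) (ℓ : R51 →L[ℝ] ℂ)
    {m : R51 →L[ℝ] ℂ} (hm0 : ∀ x ∈ H4, m x ≠ 0) (t : ℝ) :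
    deriv (deriv fun s => ℓ (γ s) / m (γ s)) t =
      -2 * (ℓ (deriv γ t) * m (γ t) - ℓ (γ t) * m (deriv γ t)) * m (deriv γ t) / m (γ t) ^ 3 := by
  have hdiff : DifferentiableAt ℝ γ t := hγ.smooth.differentiable (by simp) t
  have hsmooth : ∀ k : R51 →L[ℝ] ℂ, ContDiff ℝ 2 fun s => k (γ s) := fun k =>
    (k.contDiff.comp hγ.smooth).of_le (by norm_cast)
  rw [_root_.deriv_deriv_div (hsmooth ℓ) (hsmooth m) (fun s => hm0 _ (hγ.mem s))
    (hγ.deriv_deriv_continuousLinearMap_comp ℓ t) (hγ.deriv_deriv_continuousLinearMap_comp m t),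
    deriv_continuousLinearMap_comp ℓ hdiff, deriv_continuousLinearMap_comp m hdiff]

theorem isHarmonicMorphismH4_div {ℓ m : R51 →L[ℝ] ℂ} (hℓℓ : lorDual ℓ ℓ = 0)
    (hℓm : lorDual ℓ m = 0) (hmm : lorDual m m = 0) (hm0 : ∀ x ∈ H4, m x ≠ 0) :
    IsHarmonicMorphismH4 fun x => ℓ x / m x := by
  have hsmooth : ContDiffOn ℝ ∞ (fun x => ℓ x / m x) H4 := by
    simp only [div_eq_mul_inv]
    exact ℓ.contDiff.contDiffOn.mul (m.contDiff.contDiffOn.inv hm0)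
  refine isHarmonicMorphismH4_of_geodesic_frames hsmooth fun γ p hp hγ hv => ?_
  have hℓℓp := hv.sum_mul_apply hp.1 ℓ ℓ
  have hℓmp := hv.sum_mul_apply hp.1 ℓ m
  have hmmp := hv.sum_mul_apply hp.1 m m
  rw [hℓℓ, zero_add] at hℓℓp
  rw [hℓm, zero_add] at hℓmp
  rw [hmm, zero_add] at hmmp
  set w : Fin 4 → ℂ := fun i => ℓ (deriv (γ i) 0) * m p - ℓ p * m (deriv (γ i) 0) with hw
  have hderiv : ∀ i, deriv (fun t => ℓ (γ i t) / m (γ i t)) 0 = w i / m p ^ 2 := fun i => by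
    rw [(hγ i).1.deriv_div ℓ (hm0 _ ((hγ i).1.mem 0)), (hγ i).2]
  have hderiv2 : ∀ i, deriv (deriv fun t => ℓ (γ i t) / m (γ i t)) 0 =
      -2 * w i * m (deriv (γ i) 0) / m p ^ 3 := fun i => by
    rw [(hγ i).1.deriv_deriv_div ℓ hm0, (hγ i).2]
  have hww : ∑ i, w i ^ 2 = 0 := by
    simp only [Fin.sum_univ_four, hw] at hℓℓp hℓmp hmmp ⊢
    linear_combination m p ^ 2 * hℓℓp - 2 * ℓ p * m p * hℓmp + ℓ p ^ 2 * hmmp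
  have hwm : ∑ i, w i * m (deriv (γ i) 0) = 0 := by
    simp only [Fin.sum_univ_four, hw] at hℓmp hmmp ⊢
    linear_combination m p * hℓmp - ℓ p * hmmp
  constructor
  · simp only [Function.comp_def, hderiv, div_pow, ← Finset.sum_div, hww, zero_div]
  · simp only [Function.comp_def, hderiv2, mul_assoc, ← Finset.sum_div, ← Finset.mul_sum, hwm,
      mul_zero, zero_div]

/-! ### The forms `ℓ` and `m` -/

theorem exists_sum_mul_ofReal_eq {ι : Type*} [Fintype ι] {ξ : ι → ℂ} (hξ : ∑ i, ξ i ^ 2 = 0)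
    (hξ0 : ξ ≠ 0) (z : ℂ) : ∃ y : ι → ℝ, ∑ i, ξ i * y i = z := by
  set N := ∑ i, Complex.normSq (ξ i) with hN
  have hN0 : (N : ℂ) ≠ 0 := by
    obtain ⟨k, hk⟩ := Function.ne_iff.1 hξ0
    have : 0 < N := Finset.sum_pos' (fun i _ => Complex.normSq_nonneg _)
      ⟨k, Finset.mem_univ k, Complex.normSq_pos.2 hk⟩
    exact_mod_cast this.ne'
  refine ⟨fun k => 2 * (z * conj (ξ k)).re / N, ?_⟩
  have hterm : ∀ k, ξ k * ((2 * (z * conj (ξ k)).re / N : ℝ) : ℂ) =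
      (z * Complex.normSq (ξ k) + conj z * ξ k ^ 2) / N := fun k => by
    have hre : ((2 * (z * conj (ξ k)).re : ℝ) : ℂ) = z * conj (ξ k) + conj z * ξ k := by
      rw [← Complex.add_conj, map_mul, Complex.conj_conj]
    rw [Complex.ofReal_div, hre, ← Complex.mul_conj]
    ring
  rw [Finset.sum_congr rfl fun k _ => hterm k, ← Finset.sum_div, Finset.sum_add_distrib,
    ← Finset.mul_sum, ← Finset.mul_sum, hξ, ← Complex.ofReal_sum, ← hN, mul_zero, add_zero,
    mul_div_cancel_right₀ z hN0]

/-- The `i`-th coordinate of `ℝ⁵₁` as a complex-valued form. -/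
noncomputable def coordForm (i : Fin 5) : R51 →L[ℝ] ℂ :=
  Complex.ofRealCLM ∘L ContinuousLinearMap.proj (φ := fun _ => ℝ) i

/-- The form `x ↦ ξ₁x₁ + ξ₂x₂ + ξ₃x₃`; up to a constant, `P` is its square for
`ξ = (a₁, b₁, b₂)`. -/
noncomputable def spatialForm (ξ : Fin 3 → ℂ) : R51 →L[ℝ] ℂ :=
  ∑ i, ξ i • coordForm (i.castAdd 2)

/-- The form `x ↦ x₅ - x₄`, whose square is `Q`, with the sign that makes it positive on `H⁴`. -/
noncomputable def nullForm : R51 →L[ℝ] ℂ :=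
  coordForm 4 - coordForm 3

theorem spatialForm_apply (ξ : Fin 3 → ℂ) (x : R51) :
    spatialForm ξ x = ξ 0 * x 0 + ξ 1 * x 1 + ξ 2 * x 2 := by
  simp only [spatialForm, Fin.sum_univ_three]
  rfl

theorem nullForm_apply (x : R51) : nullForm x = (x 4 : ℂ) - x 3 := rfl

theorem lorDual_spatialForm_self (ξ : Fin 3 → ℂ) :
    lorDual (spatialForm ξ) (spatialForm ξ) = ∑ i, ξ i ^ 2 := by
  simp [lorDual, Fin.sum_univ_five, Fin.sum_univ_three, spatialForm_apply, lor, sq]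

theorem lorDual_spatialForm_nullForm (ξ : Fin 3 → ℂ) :
    lorDual (spatialForm ξ) nullForm = 0 := by
  simp [lorDual, Fin.sum_univ_five, spatialForm_apply, nullForm_apply, lor]

theorem lorDual_nullForm_self : lorDual nullForm nullForm = 0 := by
  simp [lorDual, Fin.sum_univ_five, nullForm_apply, lor]

theorem nullForm_ne_zero {x : R51} (hx : x ∈ H4) : nullForm x ≠ 0 := by
  have hlt : x 3 < x 4 := by
    have hq := hx.1
    rw [lor] at hq
    refine lt_of_pow_lt_pow_left₀ 2 hx.2.le ?_
    nlinarith [sq_nonneg (x 0), sq_nonneg (x 1), sq_nonneg (x 2)]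
  rw [nullForm_apply]
  exact_mod_cast (sub_pos.2 hlt).ne'

theorem surjective_spatialForm_sub_smul_nullForm {ξ : Fin 3 → ℂ} (hξ : ∑ i, ξ i ^ 2 = 0)
    (hξ0 : ξ ≠ 0) (c : ℂ) : Function.Surjective (spatialForm ξ - c • nullForm) := fun z => by
  obtain ⟨y, hy⟩ := exists_sum_mul_ofReal_eq hξ hξ0 z
  refine ⟨![y 0, y 1, y 2, 0, 0], ?_⟩
  simpa [spatialForm_apply, nullForm_apply, Fin.sum_univ_three] using hy

theorem exists_mem_H4_spatialForm_eq {ξ : Fin 3 → ℂ} (hξ : ∑ i, ξ i ^ 2 = 0) (hξ0 : ξ ≠ 0)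
    (c : ℂ) : ∃ x ∈ H4, spatialForm ξ x = c * nullForm x := by
  obtain ⟨y, hy⟩ := exists_sum_mul_ofReal_eq hξ hξ0 c
  set q := 1 + y 0 ^ 2 + y 1 ^ 2 + y 2 ^ 2 with hq
  refine ⟨![y 0, y 1, y 2, (q - 1) / 2, (q + 1) / 2], ⟨?_, ?_⟩, ?_⟩
  · simp only [lor, Matrix.cons_val]
    linear_combination -hq
  · change 0 < (q + 1) / 2
    positivity
  · rw [Fin.sum_univ_three] at hy
    simp only [spatialForm_apply, nullForm_apply, Matrix.cons_val, hy]
    push_cast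
    ring

theorem finrank_ker_of_surjective {L : R51 →L[ℝ] ℂ} (hL : Function.Surjective L) :
    finrank ℝ L.ker = 3 := by
  have h := LinearMap.finrank_range_add_finrank_ker L.toLinearMap
  rw [LinearMap.range_eq_top.2 hL, finrank_top, Complex.finrank_real_complex,
    finrank_fin_fun] at h
  omega

theorem isUnionOfHyperbolicSubspaces_sq_eq_mul_sq {ℓ m : R51 →L[ℝ] ℂ}
    (hm0 : ∀ x ∈ H4, m x ≠ 0) (hsurj : ∀ c : ℂ, Function.Surjective (ℓ - c • m)) (α : ℂ) :
    IsUnionOfHyperbolicSubspaces 2 {x ∈ H4 | ℓ x ^ 2 = α * m x ^ 2} := by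
  rintro p ⟨hp, hpα⟩
  set c := ℓ p / m p with hc
  have hα : α = c ^ 2 := by
    rw [hc, div_pow, hpα, mul_div_cancel_right₀ _ (pow_ne_zero 2 (hm0 p hp))]
  have hsq : ∀ x, ℓ x ^ 2 = α * m x ^ 2 ↔ ℓ x = c * m x ∨ ℓ x = -(c * m x) := fun x => by
    rw [hα, ← mul_pow, sq_eq_sq_iff_eq_or_eq_neg]
  -- The two planes `ℓ = ± c m` coincide if `c = 0` and are disjoint in `H⁴` otherwise.
  have hbranch : ∀ x ∈ H4, ℓ x = c * m x → ℓ x + c * m x ≠ 0 ∨ c = 0 := fun x hx hxc => by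
    rw [hxc, ← two_mul, or_iff_not_imp_right]
    exact fun hc0 => mul_ne_zero two_ne_zero (mul_ne_zero hc0 (hm0 x hx))
  refine ⟨(ℓ - c • m).ker, finrank_ker_of_surjective (hsurj c),
    {x | ℓ x + c * m x ≠ 0 ∨ c = 0},
    (isOpen_ne_fun (by fun_prop) continuous_const).union isOpen_const,
    hbranch p hp (div_mul_cancel₀ _ (hm0 p hp)).symm, ?_⟩
  ext x
  have hker : x ∈ (ℓ - c • m).ker ↔ ℓ x = c * m x := sub_eq_zero
  simp only [Set.mem_inter_iff, Set.mem_ofPred_eq, SetLike.mem_coe, and_assoc, hsq, hker]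
  refine and_congr_right fun hx => ⟨?_, fun hxc => ⟨.inl hxc, hbranch x hx hxc⟩⟩
  rintro ⟨hxc | hxc, hne | hc0⟩
  · exact hxc
  · exact hxc
  · exact absurd (by rw [hxc, neg_add_cancel]) hne
  · simpa only [hc0, zero_mul, neg_zero] using hxc

theorem quadQ_eq (x : R51) : quadQ x = nullForm x ^ 2 := by
  rw [quadQ, nullForm_apply]; ring

theorem quadQ_ne_zero {x : R51} (hx : x ∈ H4) : quadQ x ≠ 0 := by
  rw [quadQ_eq]
  exact pow_ne_zero 2 (nullForm_ne_zero hx)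

section

variable {a₁ a₂ b₁ b₂ b₃ : ℂ} (h₁ : a₁ ^ 2 + b₁ ^ 2 + b₂ ^ 2 = 0) (h₂ : a₁ * a₂ = -b₂ ^ 2)
  (h₃ : a₁ * b₃ = b₁ * b₂) (ha₁ : a₁ ≠ 0)
include h₁ h₂ h₃

theorem mul_quadP_eq (x : R51) :
    a₁ * quadP a₁ a₂ b₁ b₂ b₃ x = spatialForm ![a₁, b₁, b₂] x ^ 2 := by
  simp only [quadP, spatialForm_apply, Matrix.cons_val]
  linear_combination (-(x 1 : ℂ) ^ 2) * h₁ + ((x 1 : ℂ) ^ 2 - (x 2 : ℂ) ^ 2) * h₂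
    + 2 * (x 1 : ℂ) * (x 2 : ℂ) * h₃

include ha₁

theorem quadP_div_quadQ_eq (x : R51) :
    quadP a₁ a₂ b₁ b₂ b₃ x / quadQ x =
      (spatialForm ![a₁, b₁, b₂] x / nullForm x) ^ 2 / a₁ := by
  rw [quadQ_eq, div_pow, ← mul_quadP_eq h₁ h₂ h₃, div_right_comm, mul_div_cancel_left₀ _ ha₁]

theorem quadP_eq_mul_quadQ_iff (α : ℂ) (x : R51) :
    quadP a₁ a₂ b₁ b₂ b₃ x = α * quadQ x ↔
      spatialForm ![a₁, b₁, b₂] x ^ 2 = a₁ * α * nullForm x ^ 2 := by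
  rw [← mul_quadP_eq h₁ h₂ h₃, quadQ_eq, mul_assoc, mul_right_inj' ha₁]

end

theorem mainTheorem2_general (a₁ a₂ b₁ b₂ b₃ : ℂ)
    (h₁ : a₁ ^ 2 + b₁ ^ 2 + b₂ ^ 2 = 0) (h₂ : a₁ * a₂ = -b₂ ^ 2) (h₃ : a₁ * b₃ = b₁ * b₂)
    (ha₁ : a₁ ≠ 0) :
    (∀ x ∈ H4, quadQ x ≠ 0) ∧
    IsHarmonicMorphismH4 (fun x => quadP a₁ a₂ b₁ b₂ b₃ x / quadQ x) ∧
    ∀ α : ℂ,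
      {x ∈ H4 | quadP a₁ a₂ b₁ b₂ b₃ x / quadQ x = α} =
        {x ∈ H4 | quadP a₁ a₂ b₁ b₂ b₃ x = α * quadQ x} ∧
      IsMinimalSurfaceH4 {x ∈ H4 | quadP a₁ a₂ b₁ b₂ b₃ x = α * quadQ x} ∧
      IsCompleteSubmanifold {x ∈ H4 | quadP a₁ a₂ b₁ b₂ b₃ x = α * quadQ x} := by
  have hξ : ∑ i, ![a₁, b₁, b₂] i ^ 2 = 0 := by simpa [Fin.sum_univ_three] using h₁
  have hξ0 : ![a₁, b₁, b₂] ≠ 0 := fun h => ha₁ (congrFun h 0)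
  refine ⟨fun x => quadQ_ne_zero, ?_, fun α => ⟨?_, ?_⟩⟩
  · simp only [quadP_div_quadQ_eq h₁ h₂ h₃ ha₁]
    exact (isHarmonicMorphismH4_div ((lorDual_spatialForm_self _).trans hξ)
      (lorDual_spatialForm_nullForm _) lorDual_nullForm_self fun x =>
        nullForm_ne_zero).comp_differentiable (g := fun z => z ^ 2 / a₁) (by fun_prop)
  · ext x
    exact and_congr_right fun hx => div_eq_iff (quadQ_ne_zero hx)
  · simp only [quadP_eq_mul_quadQ_iff h₁ h₂ h₃ ha₁]
    have hfibre := isUnionOfHyperbolicSubspaces_sq_eq_mul_sq (fun x => nullForm_ne_zero)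
      (surjective_spatialForm_sub_smul_nullForm hξ hξ0) (a₁ * α)
    refine ⟨hfibre.isMinimalSurfaceH4 ?_, hfibre.isCompleteSubmanifold⟩
    obtain ⟨c, hc⟩ := IsAlgClosed.exists_pow_nat_eq (a₁ * α) two_pos
    obtain ⟨x, hx, hxc⟩ := exists_mem_H4_spatialForm_eq hξ hξ0 c
    exact ⟨x, hx, by rw [hxc, mul_pow, hc]⟩

theorem mainTheorem2 (a₁ a₂ b₁ b₂ b₃ : ℂ)
    (h₁ : a₁ ^ 2 + b₁ ^ 2 + b₂ ^ 2 = 0) (h₂ : a₁ * a₂ = -b₂ ^ 2) (h₃ : a₁ * b₃ = b₁ * b₂)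
    (h₀ : a₁ * b₁ * b₂ ≠ 0) :
    (∀ x ∈ H4, quadQ x ≠ 0) ∧
    IsHarmonicMorphismH4 (fun x => quadP a₁ a₂ b₁ b₂ b₃ x / quadQ x) ∧
    ∀ α : ℂ, α ≠ 0 → α ∈ (fun x => quadP a₁ a₂ b₁ b₂ b₃ x / quadQ x) '' H4 →
      {x ∈ H4 | quadP a₁ a₂ b₁ b₂ b₃ x / quadQ x = α} =
        {x ∈ H4 | quadP a₁ a₂ b₁ b₂ b₃ x = α * quadQ x} ∧
      IsMinimalSurfaceH4 {x ∈ H4 | quadP a₁ a₂ b₁ b₂ b₃ x = α * quadQ x} ∧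
      IsCompleteSubmanifold {x ∈ H4 | quadP a₁ a₂ b₁ b₂ b₃ x = α * quadQ x} := by
  obtain ⟨hQ, hΦ, hfibre⟩ :=
    mainTheorem2_general a₁ a₂ b₁ b₂ b₃ h₁ h₂ h₃ (left_ne_zero_of_mul (left_ne_zero_of_mul h₀))
  exact ⟨hQ, hΦ, fun α _ _ => hfibre α⟩
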